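/- For a positive integer $n$ let $\Omega(n)$ denote the number of prime factors of $n$ counted with multiplicity. Let $\alpha \geq 1$ be a real number. Then, as the real variable $X$ tends to infinity, \[ \sum_{1\le n\leq X} \Omega(n)^\alpha = X (\log\log X)^\alpha + O\left( X (\log\log X)^{\alpha-1} \right), \] where the implied constant may depend on $\alpha$. In particular, $\Omega(n)^\alpha$ has average order $(\log\log n)^\alpha$, in the sense that \[ \frac1X \sum_{1\le n\leq X} \Omega(n)^\alpha \asymp (\log\log X)^\alpha \qquad (X\to\infty), \] that is, for all sufficiently large $X$ each side is at most a constant (depending only on $\alpha$) times the other. -/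

import Mathlib

/-- The arithmetic function `f` has average order `g`:
`(1 / X) * ∑_{1 ≤ n ≤ X} f n ≍ g X` as the real variable `X` tends to infinity. -/
def HasAverageOrder (f : ℕ → ℝ) (g : ℝ → ℝ) : Prop :=
  (fun X : ℝ => (1 / X) * ∑ n ∈ Finset.Icc 1 ⌊X⌋₊, f n) =Θ[Filter.atTop] g

/-!
Write `P(N) = ∑_{p ≤ N} 1 / p`, so that `P(N) = log log N + O(1)` by Mertens. Counting the pairs
`(p, j)` with `p ^ j ∣ n` gives `∑ f(n) Ω(n) = ∑_{p, j} ∑_{m ≤ N / p ^ j} f(p ^ j m)`. For `f = 1`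
the terms with `j = 1` show that `Ω` has mean at least `P(N) - 1` over `n ≤ N`. For
`f = Ω ^ k` one has `f(p ^ j m) = (Ω(m) + j) ^ k`, and since `∑_{p, j} j ^ k / p ^ j = P(N) + O(1)`,
induction on `k` bounds the `k`-th moment of `Ω` by `(P(N) + O_k(1)) ^ k`.
The power mean inequality turns these into bounds for every real moment of order `α ≥ 1`, and
`(L + O(1)) ^ α = L ^ α + O(L ^ (α - 1))` for `L = log log X`.
-/

open Filter Asymptotics Finset
open Nat (primesLE mem_primesLE prime_of_mem_primesLE)
open Real (log)
open ArithmeticFunction (cardFactors)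

section Mertens

/-- The partial sum of `∑ 1 / p` over the primes `p ≤ N`, which is the size of `Ω` on average over
`n ≤ N`. -/
noncomputable def primeReciprocalSum (N : ℕ) : ℝ := ∑ p ∈ primesLE N, (p : ℝ)⁻¹

lemma primeReciprocalSum_nonneg (N : ℕ) : 0 ≤ primeReciprocalSum N :=
  sum_nonneg fun _ _ => by positivity

lemma sum_primesLE_log_mul_div_le (N : ℕ) :
    ∑ p ∈ primesLE N, log p * ((N / p : ℕ) : ℝ) ≤ N * log N := by
  calc ∑ p ∈ primesLE N, log p * ((N / p : ℕ) : ℝ)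
      = ∑ p ∈ primesLE N, ArithmeticFunction.vonMangoldt p * ((N / p : ℕ) : ℝ) :=
        sum_congr rfl fun p hp => by
          rw [ArithmeticFunction.vonMangoldt_apply_prime (prime_of_mem_primesLE hp)]
    _ ≤ ∑ d ∈ Ioc 0 N, ArithmeticFunction.vonMangoldt d * ((N / d : ℕ) : ℝ) := by
        rw [Nat.primesLE_eq_filter_Ioc_zero]
        refine sum_le_sum_of_subset_of_nonneg (filter_subset _ _) fun d _ _ => ?_
        exact mul_nonneg ArithmeticFunction.vonMangoldt_nonneg (Nat.cast_nonneg _)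
    _ = ∑ n ∈ Ioc 0 N, log n := by
        rw [← ArithmeticFunction.sum_Ioc_mul_zeta_eq_sum, ArithmeticFunction.vonMangoldt_mul_zeta]
        rfl
    _ ≤ ∑ _n ∈ Ioc 0 N, log N := by
        refine sum_le_sum fun n hn => ?_
        obtain ⟨hn0, hnN⟩ := mem_Ioc.mp hn
        gcongr
    _ = N * log N := by simp

lemma sum_primesLE_log_div_le (N : ℕ) : ∑ p ∈ primesLE N, log p / p ≤ log N + log 4 := by
  rcases N.eq_zero_or_pos with rfl | hN
  · simpa using Real.log_nonneg (by norm_num : (1 : ℝ) ≤ 4)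
  have htheta : ∑ p ∈ primesLE N, log p ≤ log 4 * N := by
    rw [← Chebyshev.theta_eq_sum_primesLE_log]
    exact Chebyshev.theta_le_log4_mul_x N.cast_nonneg
  have hmul : N * ∑ p ∈ primesLE N, log p / p ≤ N * (log N + log 4) := by
    calc N * ∑ p ∈ primesLE N, log p / p
        = ∑ p ∈ primesLE N, log p * ((N : ℝ) / p) := by
          rw [mul_sum]
          exact sum_congr rfl fun p _ => by ring
      _ ≤ ∑ p ∈ primesLE N, log p * (((N / p : ℕ) : ℝ) + 1) := by
          gcongr with p
          rw [← Nat.floor_div_eq_div (K := ℝ)]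
          exact (Nat.lt_floor_add_one _).le
      _ = ∑ p ∈ primesLE N, log p * ((N / p : ℕ) : ℝ) + ∑ p ∈ primesLE N, log p := by
          simp only [mul_add, mul_one, sum_add_distrib]
      _ ≤ N * (log N + log 4) := by linarith [sum_primesLE_log_mul_div_le N]
  exact le_of_mul_le_mul_left hmul (by exact_mod_cast hN)

/-- The completely multiplicative function `n ↦ n ^ (-s)`, bundled so that Mathlib's Euler product
lemmas apply to it. -/
noncomputable def rpowNegHom (s : ℝ) : ℕ →* ℝ where
  toFun n := (n : ℝ) ^ (-s)
  map_one' := by simp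
  map_mul' m n := by
    rw [Nat.cast_mul, Real.mul_rpow m.cast_nonneg n.cast_nonneg]

lemma rpowNegHom_apply (s : ℝ) (n : ℕ) : rpowNegHom s n = (n : ℝ) ^ (-s) := rfl

lemma rpowNegHom_one_apply (n : ℕ) : rpowNegHom 1 n = (n : ℝ)⁻¹ := Real.rpow_neg_one _

lemma rpowNegHom_nonneg (s : ℝ) (n : ℕ) : 0 ≤ rpowNegHom s n :=
  Real.rpow_nonneg n.cast_nonneg _

lemma rpowNegHom_le_half {s : ℝ} (hs : 1 ≤ s) {n : ℕ} (hn : 2 ≤ n) : rpowNegHom s n ≤ 1 / 2 := by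
  have hn2 : (2 : ℝ) ≤ n := by exact_mod_cast hn
  calc (n : ℝ) ^ (-s) ≤ (n : ℝ) ^ (-1 : ℝ) := by gcongr; linarith
    _ = 1 / n := by rw [Real.rpow_neg_one, one_div]
    _ ≤ 1 / 2 := by gcongr

lemma one_sub_rpowNegHom_pos {s : ℝ} (hs : 1 ≤ s) {N p : ℕ} (hp : p ∈ primesLE N) :
    0 < 1 - rpowNegHom s p := by
  linarith [rpowNegHom_le_half hs (Nat.two_le_of_mem_primesLE hp)]

lemma log_prod_one_sub_rpowNegHom_inv {s : ℝ} (hs : 1 ≤ s) (N : ℕ) :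
    log (∏ p ∈ primesLE N, (1 - rpowNegHom s p)⁻¹) =
      ∑ p ∈ primesLE N, -log (1 - rpowNegHom s p) := by
  rw [Real.log_prod fun p hp => inv_ne_zero (one_sub_rpowNegHom_pos hs hp).ne']
  simp only [Real.log_inv]

lemma summable_rpowNegHom {s : ℝ} (hs : 1 < s) : Summable (rpowNegHom s) :=
  Real.summable_nat_rpow.mpr (neg_lt_neg hs)

lemma tsum_rpowNegHom_le {s : ℝ} (hs : 1 < s) : ∑' n, rpowNegHom s n ≤ 1 + 1 / (s - 1) := by
  have hterm : ∀ n : ℕ, rpowNegHom s (n + 1) = 1 / ((n : ℝ) + 1) ^ s := fun n => by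
    rw [rpowNegHom_apply, Real.rpow_neg (Nat.cast_nonneg _), one_div, Nat.cast_succ]
  have hzero : rpowNegHom s 0 = 0 := by
    rw [rpowNegHom_apply, Nat.cast_zero, Real.zero_rpow (by linarith)]
  have hzeta := ZetaAsymptotics.zeta_limit_aux1 hs
  have herr : 0 ≤ s * ZetaAsymptotics.termTSum s :=
    mul_nonneg (by linarith) (tsum_nonneg fun n => ZetaAsymptotics.term_nonneg _ _)
  rw [(summable_rpowNegHom hs).tsum_eq_zero_add, hzero]
  simp only [hterm]
  linarith

lemma sum_primesLE_rpowNegHom_le {s : ℝ} (hs : 1 < s) (N : ℕ) :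
    ∑ p ∈ primesLE N, rpowNegHom s p ≤ log (1 + 1 / (s - 1)) := by
  have hprod : ∏ p ∈ primesLE N, (1 - rpowNegHom s p)⁻¹ ≤ 1 + 1 / (s - 1) := by
    have hsum := summable_rpowNegHom hs
    rw [primesLE, EulerProduct.prod_primesBelow_geometric_eq_tsum_smoothNumbers hsum]
    exact (hsum.tsum_subtype_le _ _ (rpowNegHom_nonneg s)).trans (tsum_rpowNegHom_le hs)
  calc ∑ p ∈ primesLE N, rpowNegHom s p
      ≤ ∑ p ∈ primesLE N, -log (1 - rpowNegHom s p) := by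
        gcongr with p hp
        linarith [Real.log_le_sub_one_of_pos (one_sub_rpowNegHom_pos hs.le hp)]
    _ = log (∏ p ∈ primesLE N, (1 - rpowNegHom s p)⁻¹) :=
        (log_prod_one_sub_rpowNegHom_inv hs.le N).symm
    _ ≤ log (1 + 1 / (s - 1)) :=
        Real.log_le_log (prod_pos fun p hp => inv_pos.mpr (one_sub_rpowNegHom_pos hs.le hp)) hprod

lemma inv_sub_rpow_neg_le {x : ℝ} (hx : 0 < x) (s : ℝ) :
    x⁻¹ - x ^ (-s) ≤ (s - 1) * (log x / x) := by
  have hexp := Real.add_one_le_exp (log x * (1 - s))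
  calc x⁻¹ - x ^ (-s) = x⁻¹ * (1 - Real.exp (log x * (1 - s))) := by
        rw [← Real.rpow_def_of_pos hx, mul_sub, ← Real.rpow_neg_one, ← Real.rpow_add hx]
        ring_nf
    _ ≤ x⁻¹ * ((s - 1) * log x) := by gcongr; linarith
    _ = (s - 1) * (log x / x) := by ring

-- Rankin's trick: move the exponent from `1` to `s > 1`, where the full Euler product converges.
lemma primeReciprocalSum_le_of_one_lt {s : ℝ} (hs : 1 < s) (N : ℕ) :
    primeReciprocalSum N ≤ log (1 + 1 / (s - 1)) + (s - 1) * (log N + log 4) := by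
  calc primeReciprocalSum N
      ≤ ∑ p ∈ primesLE N, (rpowNegHom s p + (s - 1) * (log p / p)) := by
        refine sum_le_sum fun p hp => ?_
        have hp0 : (0 : ℝ) < p := by exact_mod_cast (prime_of_mem_primesLE hp).pos
        linarith [inv_sub_rpow_neg_le hp0 s, rpowNegHom_apply s p]
    _ = ∑ p ∈ primesLE N, rpowNegHom s p + (s - 1) * ∑ p ∈ primesLE N, log p / p := by
        rw [sum_add_distrib, mul_sum]
    _ ≤ log (1 + 1 / (s - 1)) + (s - 1) * (log N + log 4) := by
        gcongr
        · exact sum_primesLE_rpowNegHom_le hs N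
        · exact sum_primesLE_log_div_le N

lemma primeReciprocalSum_le {N : ℕ} (hN : 3 ≤ N) :
    primeReciprocalSum N ≤ log (log N) + 1 + log 2 + log 4 := by
  have hlog : 1 ≤ log N := by
    rw [Real.le_log_iff_exp_le (by positivity)]
    exact Real.exp_one_lt_three.le.trans (by exact_mod_cast hN)
  have hrankin := primeReciprocalSum_le_of_one_lt
    (lt_add_of_pos_right 1 (one_div_pos.mpr (by linarith : 0 < log N))) N
  rw [add_sub_cancel_left, one_div_one_div] at hrankin
  have hmain : log (1 + log N) ≤ log 2 + log (log N) := by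
    rw [← Real.log_mul two_ne_zero (by linarith)]
    exact Real.log_le_log (by linarith) (by linarith)
  have herr : 1 / log N * (log N + log 4) ≤ 1 + log 4 := by
    rw [mul_add, one_div_mul_cancel (by linarith)]
    gcongr
    exact mul_le_of_le_one_left (Real.log_nonneg (by norm_num))
      ((div_le_one (by linarith)).mpr hlog)
  linarith

lemma harmonic_le_prod_one_sub_rpowNegHom_inv (N : ℕ) :
    (harmonic N : ℝ) ≤ ∏ p ∈ primesLE N, (1 - rpowNegHom 1 p)⁻¹ := by
  have hprod := (EulerProduct.summable_and_hasSum_smoothNumbers_prod_primesBelow_geometric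
    (f := rpowNegHom 1) (fun {p} hp => by
      rw [Real.norm_of_nonneg (rpowNegHom_nonneg 1 p)]
      linarith [rpowNegHom_le_half le_rfl hp.two_le]) (N + 1)).2
  have hsmooth : ∀ n ∈ Icc 1 N, n ∈ (N + 1).smoothNumbers := fun n hn => by
    obtain ⟨h1, hnN⟩ := mem_Icc.mp hn
    exact Nat.mem_smoothNumbers_of_lt h1 (Nat.lt_succ_of_le hnN)
  calc (harmonic N : ℝ) = ∑ n ∈ Icc 1 N, rpowNegHom 1 n := by
        simp only [harmonic_eq_sum_Icc, Rat.cast_sum, Rat.cast_inv, Rat.cast_natCast,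
          rpowNegHom_one_apply]
    _ = ∑ n ∈ (Icc 1 N).subtype (· ∈ (N + 1).smoothNumbers), rpowNegHom 1 n :=
        (sum_subtype_of_mem (fun n : ℕ => rpowNegHom 1 n) hsmooth).symm
    _ ≤ ∏ p ∈ primesLE N, (1 - rpowNegHom 1 p)⁻¹ :=
        sum_le_hasSum _ (fun n _ => rpowNegHom_nonneg 1 n) hprod

lemma neg_log_one_sub_le {x : ℝ} (hx : x ≤ 1 / 2) : -log (1 - x) ≤ x + 2 * x ^ 2 := by
  have hinv : (1 - x)⁻¹ ≤ 1 + x + 2 * x ^ 2 := by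
    rw [inv_le_iff_one_le_mul₀ (by linarith)]
    nlinarith [mul_nonneg (sq_nonneg x) (by linarith : 0 ≤ 1 - 2 * x)]
  linarith [Real.one_sub_inv_le_log_of_pos (by linarith : 0 < 1 - x)]

lemma log_log_add_one_le_primeReciprocalSum {N : ℕ} (hN : 1 ≤ N) :
    log (log (N + 1)) ≤ primeReciprocalSum N + 2 * ∑' n : ℕ, ((n : ℝ) ^ 2)⁻¹ := by
  have hharm : log (N + 1) ≤ ∏ p ∈ primesLE N, (1 - rpowNegHom 1 p)⁻¹ :=
    (by exact_mod_cast log_add_one_le_harmonic N : log (N + 1) ≤ harmonic N).trans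
      (harmonic_le_prod_one_sub_rpowNegHom_inv N)
  have hN0 : (0 : ℝ) < N := by exact_mod_cast hN
  calc log (log (N + 1))
      ≤ log (∏ p ∈ primesLE N, (1 - rpowNegHom 1 p)⁻¹) :=
        Real.log_le_log (Real.log_pos (by linarith)) hharm
    _ = ∑ p ∈ primesLE N, -log (1 - rpowNegHom 1 p) := log_prod_one_sub_rpowNegHom_inv le_rfl N
    _ ≤ ∑ p ∈ primesLE N, ((p : ℝ)⁻¹ + 2 * ((p : ℝ) ^ 2)⁻¹) := by
        gcongr with p hp
        rw [← inv_pow, ← rpowNegHom_one_apply]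
        exact neg_log_one_sub_le (rpowNegHom_le_half le_rfl (Nat.two_le_of_mem_primesLE hp))
    _ = primeReciprocalSum N + 2 * ∑ p ∈ primesLE N, ((p : ℝ) ^ 2)⁻¹ := by
        rw [sum_add_distrib, mul_sum, primeReciprocalSum]
    _ ≤ primeReciprocalSum N + 2 * ∑' n : ℕ, ((n : ℝ) ^ 2)⁻¹ := by
        gcongr
        exact (Real.summable_nat_pow_inv.mpr one_lt_two).sum_le_tsum _ fun n _ => by positivity

lemma isBigO_primeReciprocalSum_sub_log_log :
    (fun X : ℝ => primeReciprocalSum ⌊X⌋₊ - log (log X)) =O[atTop] fun _ => (1 : ℝ) := by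
  set Z : ℝ := ∑' n : ℕ, ((n : ℝ) ^ 2)⁻¹
  have hZ : 0 ≤ Z := tsum_nonneg fun n => by positivity
  have hlog2 : 0 ≤ log 2 := Real.log_nonneg one_le_two
  have hlog4 : 0 ≤ log 4 := Real.log_nonneg (by norm_num)
  refine IsBigO.of_bound (1 + log 2 + log 4 + 2 * Z) ?_
  filter_upwards [eventually_ge_atTop 3] with X hX
  have hN : 3 ≤ ⌊X⌋₊ := Nat.le_floor (by exact_mod_cast hX)
  have hN3 : (3 : ℝ) ≤ ⌊X⌋₊ := by exact_mod_cast hN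
  have hfloor : log (log ⌊X⌋₊) ≤ log (log X) :=
    Real.log_le_log (Real.log_pos (by linarith))
      (Real.log_le_log (by linarith) (Nat.floor_le (by linarith)))
  have hceil : log (log X) ≤ log (log (⌊X⌋₊ + 1)) :=
    Real.log_le_log (Real.log_pos (by linarith))
      (Real.log_le_log (by linarith) (Nat.lt_floor_add_one X).le)
  have hupper := primeReciprocalSum_le hN
  have hlower := log_log_add_one_le_primeReciprocalSum (by lia : 1 ≤ ⌊X⌋₊)
  rw [norm_one, mul_one, Real.norm_eq_abs, abs_le]
  constructor <;> linarith

end Mertens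

section Moments

lemma sum_Icc_filter_dvd {M : Type*} [AddCommMonoid M] (f : ℕ → M) (N : ℕ) {d : ℕ} (hd : 0 < d) :
    ∑ n ∈ Icc 1 N with d ∣ n, f n = ∑ m ∈ Icc 1 (N / d), f (d * m) := by
  have himage : (Icc 1 N).filter (d ∣ ·) = (Icc 1 (N / d)).image (d * ·) := by
    ext n
    simp only [mem_filter, mem_Icc, mem_image, Nat.le_div_iff_mul_le hd]
    constructor
    · rintro ⟨⟨h1, hN⟩, m, rfl⟩
      exact ⟨m, ⟨Nat.pos_of_mul_pos_left h1, mul_comm d m ▸ hN⟩, rfl⟩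
    · rintro ⟨m, ⟨h1, hN⟩, rfl⟩
      exact ⟨⟨Nat.mul_pos hd h1, mul_comm d m ▸ hN⟩, dvd_mul_right d m⟩
  rw [himage, sum_image fun _ _ _ _ h => Nat.eq_of_mul_eq_mul_left hd h]

lemma cardFactors_eq_sum_card_pow_dvd {n N : ℕ} (hn : n ∈ Icc 1 N) :
    cardFactors n = ∑ p ∈ primesLE N, #{j ∈ Icc 1 N | p ^ j ∣ n} := by
  obtain ⟨h1, hN⟩ := mem_Icc.mp hn
  have hsupport : n.factorization.support ⊆ primesLE N := fun p hp => by
    rw [Nat.support_factorization] at hp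
    exact mem_primesLE.mpr
      ⟨(Nat.le_of_mem_primeFactors hp).trans hN, Nat.prime_of_mem_primeFactors hp⟩
  rw [ArithmeticFunction.cardFactors_eq_sum_factorization,
    Finsupp.sum_of_support_subset _ hsupport _ fun _ _ => rfl]
  refine sum_congr rfl fun p hp => ?_
  have hp' := prime_of_mem_primesLE hp
  have hlt : n < p ^ (N + 1) := (Nat.lt_succ_of_le hN).trans (Nat.lt_pow_self hp'.one_lt)
  exact Nat.factorization_eq_card_pow_dvd_of_lt hp' h1 hlt

lemma sum_mul_cardFactors {R : Type*} [NonAssocSemiring R] (f : ℕ → R) (N : ℕ) :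
    ∑ n ∈ Icc 1 N, f n * (cardFactors n : R) =
      ∑ p ∈ primesLE N, ∑ j ∈ Icc 1 N, ∑ m ∈ Icc 1 (N / p ^ j), f (p ^ j * m) := by
  calc ∑ n ∈ Icc 1 N, f n * (cardFactors n : R)
      = ∑ n ∈ Icc 1 N, ∑ p ∈ primesLE N, ∑ j ∈ Icc 1 N, if p ^ j ∣ n then f n else 0 := by
        refine sum_congr rfl fun n hn => ?_
        simp only [cardFactors_eq_sum_card_pow_dvd hn, Nat.cast_sum, Finset.natCast_card_filter,
          mul_sum, mul_ite, mul_one, mul_zero]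
    _ = ∑ p ∈ primesLE N, ∑ j ∈ Icc 1 N, ∑ n ∈ Icc 1 N, if p ^ j ∣ n then f n else 0 := by
        rw [sum_comm]
        exact sum_congr rfl fun p _ => sum_comm
    _ = ∑ p ∈ primesLE N, ∑ j ∈ Icc 1 N, ∑ m ∈ Icc 1 (N / p ^ j), f (p ^ j * m) := by
        refine sum_congr rfl fun p hp => sum_congr rfl fun j _ => ?_
        rw [← sum_filter, sum_Icc_filter_dvd f N (pow_pos (prime_of_mem_primesLE hp).pos j)]

lemma mul_primeReciprocalSum_sub_one_le_sum_cardFactors (N : ℕ) :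
    N * (primeReciprocalSum N - 1) ≤ ∑ n ∈ Icc 1 N, (cardFactors n : ℝ) := by
  have hcard : (#(primesLE N) : ℝ) ≤ N := by
    have hle := card_filter_le (Icc 1 N) Nat.Prime
    rw [← Nat.primesLE_eq_filter_Icc_one, Nat.card_Icc, Nat.add_sub_cancel] at hle
    exact_mod_cast hle
  calc N * (primeReciprocalSum N - 1) ≤ N * primeReciprocalSum N - #(primesLE N) := by linarith
    _ = ∑ p ∈ primesLE N, ((N : ℝ) / p - 1) := by
        rw [sum_sub_distrib, primeReciprocalSum, mul_sum]
        simp only [div_eq_mul_inv, sum_const, nsmul_eq_mul, mul_one]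
    _ ≤ ∑ p ∈ primesLE N, ∑ _m ∈ Icc 1 (N / p ^ 1), (1 : ℝ) := by
        gcongr with p
        rw [pow_one, sum_const, Nat.card_Icc, Nat.add_sub_cancel, nsmul_one,
          ← Nat.floor_div_eq_div (K := ℝ)]
        exact (Nat.sub_one_lt_floor _).le
    _ ≤ ∑ p ∈ primesLE N, ∑ j ∈ Icc 1 N, ∑ _m ∈ Icc 1 (N / p ^ j), (1 : ℝ) := by
        refine sum_le_sum fun p hp => ?_
        have h1 : 1 ∈ Icc 1 N := mem_Icc.mpr
          ⟨le_rfl, (prime_of_mem_primesLE hp).one_le.trans (Nat.le_of_mem_primesLE hp)⟩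
        exact single_le_sum (f := fun j => ∑ _m ∈ Icc 1 (N / p ^ j), (1 : ℝ))
          (fun j _ => by positivity) h1
    _ = ∑ n ∈ Icc 1 N, (cardFactors n : ℝ) := by
        simp only [← sum_mul_cardFactors (fun _ => (1 : ℝ)) N, one_mul]

lemma sum_pow_mul_geometric_le (k N : ℕ) {x : ℝ} (hx0 : 0 ≤ x) (hx : x ≤ 1 / 2) :
    ∑ j ∈ Icc 1 N, (j : ℝ) ^ k * x ^ j ≤
      x + 4 * (∑' j : ℕ, (j : ℝ) ^ k * (1 / 2) ^ j) * x ^ 2 := by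
  have hsummable : Summable fun j : ℕ => (j : ℝ) ^ k * (1 / 2 : ℝ) ^ j :=
    summable_pow_mul_geometric_of_norm_lt_one k (by norm_num)
  have htail : ∀ j ∈ Icc 2 N, (j : ℝ) ^ k * x ^ j ≤ 4 * x ^ 2 * ((j : ℝ) ^ k * (1 / 2) ^ j) := by
    intro j hj
    obtain ⟨i, rfl⟩ := Nat.exists_eq_add_of_le (mem_Icc.mp hj).1
    calc ((2 + i : ℕ) : ℝ) ^ k * x ^ (2 + i) = ((2 + i : ℕ) : ℝ) ^ k * (x ^ 2 * x ^ i) := by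
          rw [pow_add]
      _ ≤ ((2 + i : ℕ) : ℝ) ^ k * (x ^ 2 * (1 / 2) ^ i) := by gcongr
      _ = 4 * x ^ 2 * (((2 + i : ℕ) : ℝ) ^ k * (1 / 2) ^ (2 + i)) := by ring
  have hsubset : Icc 1 N ⊆ insert 1 (Icc 2 N) := fun j hj => by
    simp only [mem_insert, mem_Icc] at hj ⊢
    lia
  calc ∑ j ∈ Icc 1 N, (j : ℝ) ^ k * x ^ j
      ≤ ∑ j ∈ insert 1 (Icc 2 N), (j : ℝ) ^ k * x ^ j :=
        sum_le_sum_of_subset_of_nonneg hsubset fun j _ _ => by positivity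
    _ = x + ∑ j ∈ Icc 2 N, (j : ℝ) ^ k * x ^ j := by
        rw [sum_insert (by simp), Nat.cast_one, one_pow, one_mul, pow_one]
    _ ≤ x + 4 * x ^ 2 * ∑ j ∈ Icc 2 N, (j : ℝ) ^ k * (1 / 2) ^ j := by
        rw [mul_sum]
        linarith [sum_le_sum htail]
    _ ≤ x + 4 * x ^ 2 * ∑' j : ℕ, (j : ℝ) ^ k * (1 / 2) ^ j := by
        gcongr
        exact hsummable.sum_le_tsum _ fun j _ => by positivity
    _ = x + 4 * (∑' j : ℕ, (j : ℝ) ^ k * (1 / 2) ^ j) * x ^ 2 := by ring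

lemma exists_sum_prime_pow_le (k : ℕ) : ∃ C : ℝ, 0 ≤ C ∧ ∀ N : ℕ,
    ∑ p ∈ primesLE N, ∑ j ∈ Icc 1 N, (j : ℝ) ^ k * (p : ℝ)⁻¹ ^ j ≤ primeReciprocalSum N + C := by
  set D : ℝ := ∑' j : ℕ, (j : ℝ) ^ k * (1 / 2) ^ j
  have hD : 0 ≤ D := tsum_nonneg fun j => by positivity
  refine ⟨4 * D * ∑' n : ℕ, ((n : ℝ) ^ 2)⁻¹,
    mul_nonneg (mul_nonneg zero_le_four hD) (tsum_nonneg fun n => by positivity), fun N => ?_⟩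
  calc ∑ p ∈ primesLE N, ∑ j ∈ Icc 1 N, (j : ℝ) ^ k * (p : ℝ)⁻¹ ^ j
      ≤ ∑ p ∈ primesLE N, ((p : ℝ)⁻¹ + 4 * D * (p : ℝ)⁻¹ ^ 2) := by
        gcongr with p hp
        have hp2 : (2 : ℝ) ≤ p := by exact_mod_cast Nat.two_le_of_mem_primesLE hp
        exact sum_pow_mul_geometric_le k N (by positivity)
          (by rw [one_div]; exact inv_anti₀ two_pos hp2)
    _ = primeReciprocalSum N + 4 * D * ∑ p ∈ primesLE N, ((p : ℝ) ^ 2)⁻¹ := by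
        simp only [sum_add_distrib, mul_sum, primeReciprocalSum, inv_pow]
    _ ≤ primeReciprocalSum N + 4 * D * ∑' n : ℕ, ((n : ℝ) ^ 2)⁻¹ := by
        gcongr
        exact (Real.summable_nat_pow_inv.mpr one_lt_two).sum_le_tsum _ fun n _ => by positivity

lemma sum_add_pow_le {R ι : Type*} [CommSemiring R] [PartialOrder R] [IsOrderedRing R]
    {s : Finset ι} {f : ι → R} {A B x : R} {k : ℕ} (hx : 0 ≤ x)
    (h : ∀ i ≤ k, ∑ m ∈ s, f m ^ i ≤ B * A ^ i) :
    ∑ m ∈ s, (f m + x) ^ k ≤ B * (A + x) ^ k := by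
  simp only [add_pow]
  rw [sum_comm, mul_sum]
  refine sum_le_sum fun i hi => ?_
  calc ∑ m ∈ s, f m ^ i * x ^ (k - i) * (k.choose i : R)
      = (∑ m ∈ s, f m ^ i) * x ^ (k - i) * (k.choose i : R) := by rw [sum_mul, sum_mul]
    _ ≤ B * A ^ i * x ^ (k - i) * (k.choose i : R) := by
        gcongr
        exact h i (mem_range_succ_iff.mp hi)
    _ = B * (A ^ i * x ^ (k - i) * (k.choose i : R)) := by simp only [mul_assoc]

lemma sum_cardFactors_prime_pow_mul_pow_le {k M p : ℕ} {A : ℝ} (hp : p.Prime) (j : ℕ)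
    (h : ∀ i ≤ k, ∑ m ∈ Icc 1 M, (cardFactors m : ℝ) ^ i ≤ M * A ^ i) :
    ∑ m ∈ Icc 1 M, (cardFactors (p ^ j * m) : ℝ) ^ k ≤ M * (A + j) ^ k := by
  have hmul : ∀ m ∈ Icc 1 M,
      (cardFactors (p ^ j * m) : ℝ) ^ k = ((cardFactors m : ℝ) + j) ^ k := fun m hm => by
    rw [ArithmeticFunction.cardFactors_mul (pow_ne_zero j hp.ne_zero)
      (Nat.one_le_iff_ne_zero.mp (mem_Icc.mp hm).1),
      ArithmeticFunction.cardFactors_apply_prime_pow hp, Nat.cast_add, add_comm]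
  rw [sum_congr rfl hmul]
  exact sum_add_pow_le j.cast_nonneg h

lemma sum_cardFactors_pow_succ_le {k N : ℕ} {A : ℝ} (hA : 0 ≤ A)
    (h : ∀ M ≤ N, ∀ i ≤ k, ∑ n ∈ Icc 1 M, (cardFactors n : ℝ) ^ i ≤ M * A ^ i) :
    ∑ n ∈ Icc 1 N, (cardFactors n : ℝ) ^ (k + 1) ≤
      N * ((A + 1) ^ k * ∑ p ∈ primesLE N, ∑ j ∈ Icc 1 N, (j : ℝ) ^ k * (p : ℝ)⁻¹ ^ j) := by
  have hterm : ∀ p ∈ primesLE N, ∀ j ∈ Icc 1 N,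
      ∑ m ∈ Icc 1 (N / p ^ j), (cardFactors (p ^ j * m) : ℝ) ^ k ≤
        N * ((A + 1) ^ k * ((j : ℝ) ^ k * (p : ℝ)⁻¹ ^ j)) := by
    intro p hp j hj
    have hj1 : (1 : ℝ) ≤ j := by exact_mod_cast (mem_Icc.mp hj).1
    have hdiv : ((N / p ^ j : ℕ) : ℝ) ≤ N * (p : ℝ)⁻¹ ^ j := by
      simpa only [Nat.cast_pow, inv_pow, div_eq_mul_inv] using
        Nat.cast_div_le (α := ℝ) (m := N) (n := p ^ j)
    calc ∑ m ∈ Icc 1 (N / p ^ j), (cardFactors (p ^ j * m) : ℝ) ^ k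
        ≤ (N / p ^ j : ℕ) * (A + j) ^ k :=
          sum_cardFactors_prime_pow_mul_pow_le (prime_of_mem_primesLE hp) j
            (h _ (Nat.div_le_self _ _))
      _ ≤ N * (p : ℝ)⁻¹ ^ j * ((A + 1) * j) ^ k := by
          gcongr
          linarith [le_mul_of_one_le_right hA hj1]
      _ = N * ((A + 1) ^ k * ((j : ℝ) ^ k * (p : ℝ)⁻¹ ^ j)) := by rw [mul_pow]; ring
  simp only [pow_succ _ k, sum_mul_cardFactors, mul_sum]
  exact sum_le_sum fun p hp => sum_le_sum fun j hj => hterm p hp j hj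

lemma primeReciprocalSum_mono : Monotone primeReciprocalSum := fun _ _ h =>
  sum_le_sum_of_subset_of_nonneg (Nat.primesLE_mono h) fun _ _ _ => by positivity

lemma exists_sum_cardFactors_pow_le (k : ℕ) : ∃ C : ℝ, 0 ≤ C ∧ ∀ N : ℕ, ∀ i ≤ k,
    ∑ n ∈ Icc 1 N, (cardFactors n : ℝ) ^ i ≤ N * (primeReciprocalSum N + C) ^ i := by
  induction k with
  | zero =>
    refine ⟨0, le_rfl, fun N i hi => ?_⟩
    simp [Nat.le_zero.mp hi]
  | succ k ih =>
    obtain ⟨C, hC, hmoment⟩ := ih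
    obtain ⟨E, hE, hprimePow⟩ := exists_sum_prime_pow_le k
    refine ⟨C + 1 + E, by positivity, fun N i hi => ?_⟩
    have hP := primeReciprocalSum_nonneg N
    rcases hi.eq_or_lt with rfl | hi
    · have hsmaller : ∀ M ≤ N, ∀ i ≤ k,
          ∑ n ∈ Icc 1 M, (cardFactors n : ℝ) ^ i ≤ M * (primeReciprocalSum N + C) ^ i := by
        intro M hM i hi
        have hPM := primeReciprocalSum_nonneg M
        refine (hmoment M i hi).trans ?_
        gcongr
        exact primeReciprocalSum_mono hM
      have hbase : primeReciprocalSum N + C + 1 ≤ primeReciprocalSum N + (C + 1 + E) := by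
        linarith
      calc ∑ n ∈ Icc 1 N, (cardFactors n : ℝ) ^ (k + 1)
          ≤ N * ((primeReciprocalSum N + C + 1) ^ k *
              ∑ p ∈ primesLE N, ∑ j ∈ Icc 1 N, (j : ℝ) ^ k * (p : ℝ)⁻¹ ^ j) :=
            sum_cardFactors_pow_succ_le (by positivity) hsmaller
        _ ≤ N * ((primeReciprocalSum N + (C + 1 + E)) ^ k *
              (primeReciprocalSum N + (C + 1 + E))) := by
            gcongr
            exact (hprimePow N).trans (by linarith)
        _ = N * (primeReciprocalSum N + (C + 1 + E)) ^ (k + 1) := by rw [pow_succ]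
    · refine (hmoment N i (Nat.lt_succ_iff.mp hi)).trans ?_
      gcongr
      linarith

end Moments

section RealMoments

lemma rpow_average_le_average_rpow {ι : Type*} {s : Finset ι} (hs : s.Nonempty) {f : ι → ℝ}
    (hf : ∀ i ∈ s, 0 ≤ f i) {a : ℝ} (ha : 1 ≤ a) :
    ((∑ i ∈ s, f i) / #s) ^ a ≤ (∑ i ∈ s, f i ^ a) / #s := by
  have hweights : ∑ _i ∈ s, (#s : ℝ)⁻¹ = 1 := by
    rw [sum_const, nsmul_eq_mul, mul_inv_cancel₀ (Nat.cast_ne_zero.mpr hs.card_ne_zero)]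
  have hmean := Real.rpow_arith_mean_le_arith_mean_rpow s _ f (fun _ _ => by positivity)
    hweights hf ha
  rwa [← mul_sum, ← mul_sum, inv_mul_eq_div, inv_mul_eq_div] at hmean

lemma card_mul_rpow_le_sum_rpow {ι : Type*} {s : Finset ι} {f : ι → ℝ}
    (hf : ∀ i ∈ s, 0 ≤ f i) {a B : ℝ} (ha : 1 ≤ a) (hB : 0 ≤ B) (h : #s * B ≤ ∑ i ∈ s, f i) :
    #s * B ^ a ≤ ∑ i ∈ s, f i ^ a := by
  rcases s.eq_empty_or_nonempty with rfl | hs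
  · simp
  have hcard : (0 : ℝ) < #s := by exact_mod_cast hs.card_pos
  rw [← le_div_iff₀' hcard] at h ⊢
  exact (Real.rpow_le_rpow hB h (by linarith)).trans (rpow_average_le_average_rpow hs hf ha)

lemma sum_rpow_le_card_mul_rpow {ι : Type*} {s : Finset ι} {f : ι → ℝ}
    (hf : ∀ i ∈ s, 0 ≤ f i) {a b B : ℝ} (ha : 0 < a) (hab : a ≤ b) (hB : 0 ≤ B)
    (h : ∑ i ∈ s, f i ^ b ≤ #s * B ^ b) :
    ∑ i ∈ s, f i ^ a ≤ #s * B ^ a := by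
  rcases s.eq_empty_or_nonempty with rfl | hs
  · simp
  have hcard : (0 : ℝ) < #s := by exact_mod_cast hs.card_pos
  have hrpow : ∀ {x : ℝ}, 0 ≤ x → (x ^ a) ^ (b / a) = x ^ b := fun hx => by
    rw [← Real.rpow_mul hx, mul_div_cancel₀ b ha.ne']
  have hmean := rpow_average_le_average_rpow hs (fun i hi => Real.rpow_nonneg (hf i hi) a)
    ((one_le_div ha).mpr hab)
  rw [sum_congr rfl fun i hi => hrpow (hf i hi)] at hmean
  rw [← div_le_iff₀' hcard] at h ⊢
  refine (Real.rpow_le_rpow_iff (z := b / a) ?_ (by positivity) ?_).mp ?_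
  · exact div_nonneg (sum_nonneg fun i hi => Real.rpow_nonneg (hf i hi) a) hcard.le
  · exact div_pos (ha.trans_le hab) ha
  · exact hmean.trans (h.trans_eq (hrpow hB).symm)

lemma exists_sum_cardFactors_rpow_le {α : ℝ} (hα : 0 < α) : ∃ C : ℝ, 0 ≤ C ∧ ∀ N : ℕ,
    ∑ n ∈ Icc 1 N, (cardFactors n : ℝ) ^ α ≤ N * (primeReciprocalSum N + C) ^ α := by
  obtain ⟨C, hC, hmoment⟩ := exists_sum_cardFactors_pow_le ⌈α⌉₊
  refine ⟨C, hC, fun N => ?_⟩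
  have hpower := sum_rpow_le_card_mul_rpow (s := Icc 1 N) (f := fun n => (cardFactors n : ℝ))
    (fun n _ => Nat.cast_nonneg _) hα (Nat.le_ceil α)
    (add_nonneg (primeReciprocalSum_nonneg N) hC)
  rw [Nat.card_Icc, Nat.add_sub_cancel] at hpower
  simp only [Real.rpow_natCast] at hpower
  exact hpower (hmoment N _ le_rfl)

lemma le_sum_cardFactors_rpow {α : ℝ} (hα : 1 ≤ α) {N : ℕ} (hN : 1 ≤ primeReciprocalSum N) :
    N * (primeReciprocalSum N - 1) ^ α ≤ ∑ n ∈ Icc 1 N, (cardFactors n : ℝ) ^ α := by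
  have hpower := card_mul_rpow_le_sum_rpow (s := Icc 1 N) (f := fun n => (cardFactors n : ℝ))
    (fun n _ => Nat.cast_nonneg _) hα (sub_nonneg.mpr hN)
  rw [Nat.card_Icc, Nat.add_sub_cancel] at hpower
  exact hpower (mul_primeReciprocalSum_sub_one_le_sum_cardFactors N)

end RealMoments

section Asymptotics

lemma tendsto_log_log : Tendsto (fun X : ℝ => log (log X)) atTop atTop :=
  Real.tendsto_log_atTop.comp Real.tendsto_log_atTop

lemma exists_eventually_sum_cardFactors_rpow_bounds {α : ℝ} (hα : 1 ≤ α) :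
    ∃ C : ℝ, 0 ≤ C ∧ ∀ᶠ X : ℝ in atTop,
      (X - 1) * (log (log X) - C) ^ α ≤ ∑ n ∈ Icc 1 ⌊X⌋₊, (cardFactors n : ℝ) ^ α ∧
      ∑ n ∈ Icc 1 ⌊X⌋₊, (cardFactors n : ℝ) ^ α ≤ X * (log (log X) + C) ^ α := by
  obtain ⟨D, hD, hmertens⟩ := isBigO_primeReciprocalSum_sub_log_log.exists_pos
  obtain ⟨C, hC, hupper⟩ := exists_sum_cardFactors_rpow_le (zero_lt_one.trans_le hα)
  refine ⟨D + C + 1, by positivity, ?_⟩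
  filter_upwards [hmertens.bound, eventually_ge_atTop 1,
    tendsto_log_log.eventually_ge_atTop (D + C + 1)] with X hX hX1 hL
  rw [norm_one, mul_one, Real.norm_eq_abs, abs_le] at hX
  have hP := primeReciprocalSum_nonneg ⌊X⌋₊
  constructor
  · refine le_trans ?_ (le_sum_cardFactors_rpow hα (by linarith))
    have hbase : log (log X) - (D + C + 1) ≤ primeReciprocalSum ⌊X⌋₊ - 1 := by linarith
    have : 0 ≤ log (log X) - (D + C + 1) := by linarith
    gcongr
    exact (Nat.sub_one_lt_floor X).le
  · refine (hupper ⌊X⌋₊).trans ?_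
    have hbase : primeReciprocalSum ⌊X⌋₊ + C ≤ log (log X) + (D + C + 1) := by linarith
    gcongr
    exact Nat.floor_le (by linarith)

lemma isBigO_add_const_rpow_sub_rpow (c a : ℝ) :
    (fun x : ℝ => (x + c) ^ a - x ^ a) =O[atTop] fun x => x ^ (a - 1) := by
  have hdiff : DifferentiableAt ℝ (fun u : ℝ => (1 + u) ^ a) 0 :=
    (differentiableAt_id.const_add 1).rpow_const (Or.inl (by simp))
  have hratio : (fun x : ℝ => (1 + c / x) ^ a - 1) =O[atTop] fun x => c / x := by
    simpa [Function.comp_def] using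
      hdiff.isBigO_sub.comp_tendsto (tendsto_const_nhds.div_atTop tendsto_id)
  have hinv : (fun x : ℝ => c / x) =O[atTop] fun x => x⁻¹ := by
    simpa only [div_eq_mul_inv] using isBigO_const_mul_self c (fun x : ℝ => x⁻¹) atTop
  refine ((isBigO_refl (fun x : ℝ => x ^ a) atTop).mul (hratio.trans hinv)).congr' ?_ ?_
  · filter_upwards [eventually_gt_atTop 0, eventually_ge_atTop (-c)] with x hx hxc
    have hratio_nonneg : 0 ≤ 1 + c / x := by
      rw [← div_self hx.ne', ← add_div]
      exact div_nonneg (by linarith) hx.le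
    rw [mul_sub, mul_one, ← Real.mul_rpow hx.le hratio_nonneg, mul_add, mul_one,
      mul_div_cancel₀ c hx.ne']
  · filter_upwards [eventually_gt_atTop 0] with x hx
    rw [Real.rpow_sub_one hx.ne', div_eq_mul_inv]

lemma isBigO_of_le_of_le {ι : Type*} {l : Filter ι} {f g h k : ι → ℝ}
    (hg : g =O[l] k) (hh : h =O[l] k) (hgf : ∀ᶠ x in l, g x ≤ f x) (hfh : ∀ᶠ x in l, f x ≤ h x) :
    f =O[l] k := by
  refine IsBigO.trans (IsBigO.of_bound' ?_) (hg.norm_left.add hh.norm_left)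
  filter_upwards [hgf, hfh] with x hgx hhx
  calc ‖f x‖ ≤ max ‖g x‖ ‖h x‖ := abs_le_max_abs_abs hgx hhx
    _ ≤ ‖g x‖ + ‖h x‖ := max_le_add_of_nonneg (norm_nonneg _) (norm_nonneg _)
    _ ≤ ‖‖g x‖ + ‖h x‖‖ := Real.le_norm_self _

lemma isBigO_log_log_sub_const_rpow {C : ℝ} (hC : 0 ≤ C) {α : ℝ} (hα : 0 ≤ α) :
    (fun X : ℝ => (log (log X) - C) ^ α) =O[atTop] fun X => X * log (log X) ^ (α - 1) := by
  refine IsBigO.of_bound' ?_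
  filter_upwards [eventually_gt_atTop 1, tendsto_log_log.eventually_gt_atTop C] with X hX hL
  have hL0 : 0 < log (log X) := hC.trans_lt hL
  have hLX : log (log X) ≤ X :=
    (Real.log_le_self (Real.log_pos hX).le).trans (Real.log_le_self (by linarith))
  rw [Real.norm_of_nonneg (Real.rpow_nonneg (by linarith) _),
    Real.norm_of_nonneg (by positivity)]
  calc (log (log X) - C) ^ α ≤ log (log X) ^ α := by gcongr; linarith
    _ = log (log X) * log (log X) ^ (α - 1) := by
        rw [Real.rpow_sub_one hL0.ne', mul_div_cancel₀ _ hL0.ne']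
    _ ≤ X * log (log X) ^ (α - 1) := by gcongr

lemma isBigO_sum_cardFactors_rpow_sub {α : ℝ} (hα : 1 ≤ α) :
    (fun X : ℝ => ∑ n ∈ Icc 1 ⌊X⌋₊, (cardFactors n : ℝ) ^ α - X * log (log X) ^ α)
      =O[atTop] fun X : ℝ => X * log (log X) ^ (α - 1) := by
  obtain ⟨C, hC, hbounds⟩ := exists_eventually_sum_cardFactors_rpow_bounds hα
  have hshift (c : ℝ) : (fun X : ℝ => X * ((log (log X) + c) ^ α - log (log X) ^ α))
      =O[atTop] fun X : ℝ => X * log (log X) ^ (α - 1) :=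
    (isBigO_refl _ _).mul ((isBigO_add_const_rpow_sub_rpow c α).comp_tendsto tendsto_log_log)
  refine isBigO_of_le_of_le ((hshift (-C)).sub (isBigO_log_log_sub_const_rpow hC (by linarith)))
    (hshift C) ?_ ?_
  · filter_upwards [hbounds] with X hX
    rw [← sub_eq_add_neg]
    linarith [hX.1]
  · filter_upwards [hbounds] with X hX
    linarith [hX.2]

lemma isLittleO_rpow_rpow {a b : ℝ} (hab : a < b) :
    (fun x : ℝ => x ^ a) =o[atTop] fun x : ℝ => x ^ b := by
  refine isLittleO_of_tendsto' ?_ ?_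
  · filter_upwards [eventually_gt_atTop 0] with x hx h
    exact absurd h (Real.rpow_pos_of_pos hx b).ne'
  · refine (tendsto_rpow_neg_atTop (sub_pos.mpr hab)).congr' ?_
    filter_upwards [eventually_gt_atTop 0] with x hx
    rw [← Real.rpow_sub hx, neg_sub]

lemma HasAverageOrder.of_isLittleO {f : ℕ → ℝ} {g : ℝ → ℝ}
    (h : (fun X : ℝ => ∑ n ∈ Icc 1 ⌊X⌋₊, f n - X * g X) =o[atTop] fun X => X * g X) :
    HasAverageOrder f g := by
  have hmean : (fun X : ℝ => (1 / X) * ∑ n ∈ Icc 1 ⌊X⌋₊, f n - g X) =o[atTop] g := by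
    refine ((isBigO_refl (fun X : ℝ => 1 / X) atTop).mul_isLittleO h).congr' ?_ ?_ <;>
    · filter_upwards [eventually_gt_atTop 0] with X hX
      field_simp
  exact IsEquivalent.isTheta hmean

end Asymptotics

theorem proposition2 (α : ℝ) (hα : 1 ≤ α) :
    ((fun X : ℝ =>
        (∑ n ∈ Finset.Icc 1 ⌊X⌋₊, (ArithmeticFunction.cardFactors n : ℝ) ^ α)
          - X * Real.log (Real.log X) ^ α)
      =O[Filter.atTop] fun X : ℝ => X * Real.log (Real.log X) ^ (α - 1)) ∧
    HasAverageOrder (fun n : ℕ => (ArithmeticFunction.cardFactors n : ℝ) ^ α)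
      (fun X : ℝ => Real.log (Real.log X) ^ α) := by
  have herror := isBigO_sum_cardFactors_rpow_sub hα
  have hlittleO : (fun X : ℝ => X * Real.log (Real.log X) ^ (α - 1)) =o[Filter.atTop]
      fun X : ℝ => X * Real.log (Real.log X) ^ α :=
    (Asymptotics.isBigO_refl _ _).mul_isLittleO
      ((isLittleO_rpow_rpow (sub_one_lt α)).comp_tendsto tendsto_log_log)
  exact ⟨herror, .of_isLittleO (herror.trans_isLittleO hlittleO)⟩
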